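/- Let $\eta(\tau)=q^{1/24}\prod_{n=1}^{\infty}(1-q^n)$, where $q=\exp(2\pi i\tau)$ and $q^{1/24}=\exp(2\pi i\tau/24)$, be the Dedekind eta function, and for each positive integer $m$ let $$\left(\frac{8}{m}\right)=\begin{cases}+1,& m\equiv\pm1\pmod 8,\\ -1,& m\equiv\pm3\pmod 8,\\ 0,& m\equiv0\pmod 2.\end{cases}$$ Then for every $\tau\in\mathbb{C}$ with $\operatorname{Im}\tau>0$, the following series converges absolutely and, with $q=\exp(2\pi i\tau)$, $$\frac{\eta^{13}(4\tau)}{\eta^2(\tau)\,\eta(2\tau)\,\eta^6(8\tau)}=1-2\sum_{n=1}^{\infty}\left(\sum_{d\mid n}\left(d\left(\frac{8}{d}\right)-2\,\frac{n}{d}\left(\frac{8}{d}\right)\right)\right)q^n,$$ where the inner sum runs over the positive divisors $d$ of $n$. -/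

import Mathlib

open Filter Topology

/-- The infinite `q`-Pochhammer symbol `(x; q)_∞`. -/
noncomputable def qPoch (q x : ℂ) : ℂ := ∏' n : ℕ, (1 - x * q ^ n)

/-- The multiplicative theta function `(x; q)_∞ (q / x; q)_∞`. -/
noncomputable def qTheta (q x : ℂ) : ℂ := qPoch q x * qPoch q (q / x)

/-- The Koebe function `t / (1 - t) ^ 2`. -/
noncomputable def koebe (t : ℂ) : ℂ := t / (1 - t) ^ 2

/-- The series `∑ n ≥ 0, koebe (x q ^ n)`. -/
noncomputable def koebeSum (q x : ℂ) : ℂ := ∑' n : ℕ, koebe (x * q ^ n)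

/-- The multiplicative form of the Weierstrass function, up to an additive constant. -/
noncomputable def qWeierstrass (q x : ℂ) : ℂ := koebeSum q x + koebeSum q (q / x)

section Pochhammer

variable {q : ℂ}

lemma summable_mul_pow (hq : ‖q‖ < 1) (x : ℂ) : Summable fun n : ℕ ↦ -(x * q ^ n) :=
  ((summable_geometric_of_norm_lt_one hq).mul_left x).neg

lemma multipliable_qPoch (hq : ‖q‖ < 1) (x : ℂ) : Multipliable fun n : ℕ ↦ 1 - x * q ^ n := by
  simpa [sub_eq_add_neg] using
    multipliable_one_add_of_summable (f := fun n : ℕ ↦ -(x * q ^ n)) (summable_mul_pow hq x).norm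

lemma qPoch_eq_mul (hq : ‖q‖ < 1) (x : ℂ) : qPoch q x = (1 - x) * qPoch q (q * x) := by
  have h := multipliable_qPoch hq (q * x)
  rw [qPoch, tprod_eq_zero_mul' (by convert h using 2; ring), qPoch]
  congr 1
  · simp
  · exact tprod_congr fun n ↦ by ring

lemma norm_mul_pow_lt_one (hq : ‖q‖ < 1) {x : ℂ} (hx : ‖x‖ < 1) (n : ℕ) : ‖x * q ^ n‖ < 1 := by
  rw [norm_mul, norm_pow]
  exact (mul_le_of_le_one_right (norm_nonneg _) (pow_le_one₀ (norm_nonneg _) hq.le)).trans_lt hx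

lemma one_sub_ne_zero_of_norm_lt_one {x : ℂ} (hx : ‖x‖ < 1) : 1 - x ≠ 0 := by
  rintro h
  rw [← sub_eq_zero.mp h] at hx
  simp at hx

lemma qPoch_ne_zero (hq : ‖q‖ < 1) {x : ℂ} (hx : ‖x‖ < 1) : qPoch q x ≠ 0 := by
  have := tprod_one_add_ne_zero_of_summable (f := fun n : ℕ ↦ -(x * q ^ n)) (fun n ↦ by
    simpa [sub_eq_add_neg] using one_sub_ne_zero_of_norm_lt_one (norm_mul_pow_lt_one hq hx n))
    (summable_mul_pow hq x).norm
  simpa [qPoch, sub_eq_add_neg] using this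

lemma differentiable_qPoch (hq : ‖q‖ < 1) : Differentiable ℂ (qPoch q) := by
  have h : HasProdLocallyUniformlyOn (fun (n : ℕ) (x : ℂ) ↦ 1 - x * q ^ n)
      (fun x ↦ ∏' n : ℕ, (1 - x * q ^ n)) Set.univ := by
    apply hasProdLocallyUniformlyOn_of_forall_compact isOpen_univ
    intro K _ hK
    obtain ⟨R, hR⟩ := hK.isBounded.exists_norm_le
    simpa [sub_eq_add_neg] using Summable.hasProdUniformlyOn_nat_one_add
      (f := fun (n : ℕ) (x : ℂ) ↦ -(x * q ^ n)) hK
      ((summable_geometric_of_lt_one (norm_nonneg _) hq).mul_left R)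
      (.of_forall fun n x hx ↦ by
        simpa using mul_le_mul_of_nonneg_right (hR x hx) (by positivity)) (fun _ ↦ by fun_prop)
  exact differentiableOn_univ.mp <| h.differentiableOn
    (.of_forall fun _ ↦ by simpa [Finset.prod_fn] using
      DifferentiableOn.finsetProd (fun _ _ ↦ by fun_prop)) isOpen_univ

/-- Bisection of the product into even and odd indices. -/
lemma qPoch_bisect (hq : ‖q‖ < 1) (x : ℂ) :
    qPoch q x = qPoch (q ^ 2) x * qPoch (q ^ 2) (x * q) := by
  have hq2 : ‖q ^ 2‖ < 1 := by simpa using pow_lt_one₀ (norm_nonneg _) hq two_ne_zero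
  have h0 := multipliable_qPoch hq2 x
  have h1 := multipliable_qPoch hq2 (x * q)
  rw [qPoch, qPoch, qPoch, ← tprod_even_mul_odd (f := fun n ↦ 1 - x * q ^ n)
    (by convert h0 using 3; ring) (by convert h1 using 3; ring)]
  congr 1
  · exact tprod_congr fun n ↦ by ring
  · exact tprod_congr fun n ↦ by ring

lemma qPoch_mul_neg (hq : ‖q‖ < 1) (x : ℂ) :
    qPoch q x * qPoch q (-x) = qPoch (q ^ 2) (x ^ 2) := by
  rw [qPoch, qPoch, ← (multipliable_qPoch hq x).tprod_mul (multipliable_qPoch hq (-x)), qPoch]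
  exact tprod_congr fun n ↦ by ring

end Pochhammer

section Theta

variable {q : ℂ}

lemma qTheta_one (hq : ‖q‖ < 1) : qTheta q 1 = 0 := by
  rw [qTheta, qPoch_eq_mul hq 1]
  simp

lemma qTheta_inv (hq : ‖q‖ < 1) {x : ℂ} (hx : x ≠ 0) : qTheta q x⁻¹ = -x⁻¹ * qTheta q x := by
  have h : q / x⁻¹ = q * x := by field_simp
  rw [qTheta, qTheta, qPoch_eq_mul hq x⁻¹, qPoch_eq_mul hq x, h, div_eq_mul_inv]
  field_simp
  ring

lemma qTheta_mul (hq : ‖q‖ < 1) (hq0 : q ≠ 0) {x : ℂ} (hx : x ≠ 0) :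
    qTheta q (q * x) = -x⁻¹ * qTheta q x := by
  have h : q / (q * x) = x⁻¹ := by field_simp
  rw [qTheta, qTheta, h, qPoch_eq_mul hq x⁻¹, qPoch_eq_mul hq x, div_eq_mul_inv]
  field_simp
  ring

lemma qTheta_eq_mul (hq : ‖q‖ < 1) (x : ℂ) :
    qTheta q x = (1 - x) * (qPoch q (q * x) * qPoch q (q / x)) := by
  rw [qTheta, qPoch_eq_mul hq x, mul_assoc]

lemma differentiableAt_qTheta (hq : ‖q‖ < 1) {x : ℂ} (hx : x ≠ 0) :
    DifferentiableAt ℂ (qTheta q) x :=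
  (differentiable_qPoch hq x).mul
    ((differentiable_qPoch hq (q / x)).comp x (by fun_prop (disch := assumption)))

end Theta

section Weierstrass

variable {q : ℂ}

lemma koebe_inv {t : ℂ} (ht : t ≠ 0) : koebe t⁻¹ = koebe t := by
  unfold koebe
  have : 1 - t⁻¹ = -(t⁻¹ * (1 - t)) := by field_simp; ring
  rw [this]
  by_cases h : 1 - t = 0
  · simp [h]
  · field_simp

lemma norm_koebe_le {t : ℂ} {r : ℝ} (hr : r < 1) (ht : ‖t‖ ≤ r) :
    ‖koebe t‖ ≤ ‖t‖ / (1 - r) ^ 2 := by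
  rw [koebe, norm_div, norm_pow]
  have h : 1 - r ≤ ‖1 - t‖ := by
    have := norm_sub_norm_le (1 : ℂ) t
    simp only [norm_one] at this
    linarith
  have : 0 < 1 - r := by linarith
  gcongr

lemma summable_koebe (hq : ‖q‖ < 1) (x : ℂ) : Summable fun n : ℕ ↦ koebe (x * q ^ n) := by
  have hs := (summable_mul_pow hq x).neg
  simp only [neg_neg] at hs
  have hs0 := hs.tendsto_atTop_zero.norm
  simp only [norm_zero] at hs0
  refine (hs.norm.div_const ((1 - 1 / 2) ^ 2)).of_norm_bounded_eventually_nat ?_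
  filter_upwards [hs0.eventually (ge_mem_nhds (by norm_num : (0 : ℝ) < 1 / 2))] with n hn
  exact norm_koebe_le (by norm_num) hn

lemma koebeSum_eq_add (hq : ‖q‖ < 1) (x : ℂ) :
    koebeSum q x = koebe x + koebeSum q (q * x) := by
  rw [koebeSum, (summable_koebe hq x).tsum_eq_zero_add, koebeSum]
  congr 1
  · simp
  · exact tsum_congr fun n ↦ by ring_nf

lemma differentiableAt_koebeSum (hq : ‖q‖ < 1) {x : ℂ} (hx : ‖x‖ < 1) :
    DifferentiableAt ℂ (koebeSum q) x := by
  obtain ⟨r, hxr, hr⟩ := exists_between hx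
  have h0 : 0 ≤ r := (norm_nonneg x).trans hxr.le
  have hd : DifferentiableOn ℂ (fun w ↦ ∑' n : ℕ, koebe (w * q ^ n)) (Metric.ball 0 r) := by
    refine Complex.differentiableOn_tsum_of_summable_norm (u := fun n ↦ r * ‖q‖ ^ n / (1 - r) ^ 2)
      (((summable_geometric_of_lt_one (norm_nonneg _) hq).mul_left r).div_const _) ?_
      Metric.isOpen_ball ?_
    · intro n w hw
      have hw1 : ‖w‖ < 1 := (by simpa using hw : ‖w‖ < r).trans hr
      have := one_sub_ne_zero_of_norm_lt_one (norm_mul_pow_lt_one hq hw1 n)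
      unfold koebe
      refine DifferentiableAt.differentiableWithinAt ?_
      exact DifferentiableAt.div (by fun_prop) (by fun_prop) (pow_ne_zero _ this)
    · intro n w hw
      have hw1 : ‖w‖ ≤ r := (by simpa using hw : ‖w‖ < r).le
      have hb : ‖w * q ^ n‖ ≤ r * ‖q‖ ^ n := by
        rw [norm_mul, norm_pow]
        gcongr
      refine (norm_koebe_le hr (hb.trans
        (mul_le_of_le_one_right h0 (pow_le_one₀ (norm_nonneg _) hq.le)))).trans ?_
      gcongr
  exact hd.differentiableAt (Metric.isOpen_ball.mem_nhds (by simpa using hxr))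

lemma qWeierstrass_eq_add (hq : ‖q‖ < 1) (x : ℂ) :
    qWeierstrass q x = koebe x + (koebeSum q (q * x) + koebeSum q (q / x)) := by
  rw [qWeierstrass, koebeSum_eq_add hq x, add_assoc]

lemma qWeierstrass_mul (hq : ‖q‖ < 1) (hq0 : q ≠ 0) {x : ℂ} (hx : x ≠ 0) :
    qWeierstrass q (q * x) = qWeierstrass q x := by
  have h : q / (q * x) = x⁻¹ := by field_simp
  rw [qWeierstrass, h, koebeSum_eq_add hq x⁻¹, koebe_inv hx, qWeierstrass_eq_add hq, div_eq_mul_inv]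
  ring

end Weierstrass

/-- A function that is analytic on an annulus around a fundamental annulus of `x ↦ q x` and
invariant under this map is constant. -/
lemma eq_of_differentiableOn_annulus_of_mul_invariant {q : ℂ} (hq : ‖q‖ < 1) (hq0 : q ≠ 0)
    {f : ℂ → ℂ} (hd : ∀ x, ‖q‖ < ‖x‖ → ‖x‖ < ‖q‖⁻¹ → DifferentiableAt ℂ f x)
    (hf : ∀ x, x ≠ 0 → f (q * x) = f x) {x y : ℂ} (hx : x ≠ 0) (hy : y ≠ 0) : f x = f y := by
  have hn0 : 0 < ‖q‖ := norm_pos_iff.mpr hq0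
  have hinv : ∀ n : ℤ, ∀ x, x ≠ 0 → f (q ^ n * x) = f x := by
    intro n
    induction n with
    | zero => simp
    | succ n ih =>
      intro x hx
      rw [zpow_add_one₀ hq0, mul_assoc, ih _ (mul_ne_zero hq0 hx), hf x hx]
    | pred n ih =>
      intro x hx
      have h := hf (q⁻¹ * x) (mul_ne_zero (inv_ne_zero hq0) hx)
      rw [zpow_sub_one₀ hq0, mul_assoc, ih _ (mul_ne_zero (inv_ne_zero hq0) hx), ← h,
        mul_inv_cancel_left₀ hq0]
  have hfund : ∀ x, x ≠ 0 → ∃ n : ℤ, ‖q‖ < ‖q ^ n * x‖ ∧ ‖q ^ n * x‖ ≤ 1 := by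
    intro x hx
    obtain ⟨n, hn1, hn2⟩ := exists_mem_Ioc_zpow (norm_pos_iff.mpr hx) ((one_lt_inv₀ hn0).mpr hq)
    rw [inv_zpow'] at hn1 hn2
    refine ⟨n + 1, ?_, ?_⟩
    · rw [norm_mul, norm_zpow, zpow_add_one₀ hn0.ne']
      have h1 : ‖q‖ ^ n * ‖q‖ ^ (-n) = 1 := by rw [← zpow_add₀ hn0.ne']; simp
      calc ‖q‖ = ‖q‖ ^ n * ‖q‖ * ‖q‖ ^ (-n) := by rw [mul_right_comm, h1, one_mul]
        _ < _ := by gcongr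
    · rw [norm_mul, norm_zpow]
      calc _ ≤ ‖q‖ ^ (n + 1) * ‖q‖ ^ (-(n + 1)) := by gcongr
        _ = 1 := by rw [← zpow_add₀ hn0.ne']; simp
  have h1i : 1 < ‖q‖⁻¹ := (one_lt_inv₀ hn0).mpr hq
  have hdiff : ∀ x, x ≠ 0 → DifferentiableAt ℂ f x := by
    intro x hx
    obtain ⟨n, h1, h2⟩ := hfund x hx
    have hdx : DifferentiableAt ℂ (fun w ↦ f (q ^ n * w)) x :=
      (hd _ h1 (h2.trans_lt h1i)).comp x (by fun_prop)
    refine hdx.congr_of_eventuallyEq ?_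
    filter_upwards [isOpen_ne.mem_nhds hx] with w hw using (hinv n w hw).symm
  have hE : Differentiable ℂ fun z ↦ f (Complex.exp z) := fun z ↦
    (hdiff _ (Complex.exp_ne_zero z)).comp z (by fun_prop)
  have hK : IsCompact (Metric.closedBall (0 : ℂ) 1 ∩ {x | ‖q‖ ≤ ‖x‖}) :=
    (isCompact_closedBall 0 1).inter_right (isClosed_le continuous_const continuous_norm)
  have hb : Bornology.IsBounded (f '' (Metric.closedBall (0 : ℂ) 1 ∩ {x | ‖q‖ ≤ ‖x‖})) := by
    refine (hK.image_of_continuousOn fun x hx ↦ ?_).isBounded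
    exact (hdiff x (norm_pos_iff.mp (hn0.trans_le hx.2))).continuousAt.continuousWithinAt
  have hr : Bornology.IsBounded (Set.range fun z ↦ f (Complex.exp z)) := by
    refine hb.subset ?_
    rintro _ ⟨z, rfl⟩
    obtain ⟨n, h1, h2⟩ := hfund _ (Complex.exp_ne_zero z)
    exact ⟨_, ⟨by simpa using h2, h1.le⟩, hinv n _ (Complex.exp_ne_zero z)⟩
  have := hE.apply_eq_apply_of_bounded hr (Complex.log x) (Complex.log y)
  simpa [Complex.exp_log hx, Complex.exp_log hy] using this

/-- Difference formula for the Weierstrass function in terms of theta functions. -/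
theorem qWeierstrass_sub {q : ℂ} (hq : ‖q‖ < 1) (hq0 : q ≠ 0) {x y : ℂ} (hx : x ≠ 0) (hy : y ≠ 0)
    (hx' : qTheta q x ≠ 0) (hy' : qTheta q y ≠ 0) :
    qWeierstrass q x - qWeierstrass q y =
      -y * qPoch q q ^ 4 * qTheta q (x * y) * qTheta q (x / y) /
        (qTheta q x ^ 2 * qTheta q y ^ 2) := by
  have hn0 : 0 < ‖q‖ := norm_pos_iff.mpr hq0
  set K : ℂ := -y * qPoch q q ^ 4 / qTheta q y ^ 2 with hK
  set T : ℂ → ℂ := fun x ↦ qPoch q (q * x) * qPoch q (q / x) with hT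
  set R : ℂ → ℂ := fun x ↦ koebeSum q (q * x) + koebeSum q (q / x) with hR
  set W : ℂ → ℂ := fun x ↦ qTheta q (x * y) * qTheta q (x / y) with hW
  set k : ℂ → ℂ := fun x ↦ x * T x ^ 2 + (1 - x) ^ 2 * T x ^ 2 * (R x - qWeierstrass q y) - K * W x
    with hk
  set h : ℂ → ℂ := fun x ↦ qWeierstrass q x - qWeierstrass q y - K * W x / qTheta q x ^ 2 with hh
  set A : Set ℂ := {x | ‖q‖ < ‖x‖ ∧ ‖x‖ < ‖q‖⁻¹} with hA
  have hAo : IsOpen A :=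
    (isOpen_lt continuous_const continuous_norm).inter (isOpen_lt continuous_norm continuous_const)
  have h1A : (1 : ℂ) ∈ A := by simpa [hA, hq] using (one_lt_inv₀ hn0).mpr hq
  have hA0 : ∀ x ∈ A, x ≠ 0 := fun x hx ↦ norm_pos_iff.mp (hn0.trans hx.1)
  have hAm : ∀ x ∈ A, ‖q * x‖ < 1 := fun x hx ↦ by
    rw [norm_mul, mul_comm]
    simpa [hn0.ne'] using mul_lt_mul_of_pos_right hx.2 hn0
  have hAd : ∀ x ∈ A, ‖q / x‖ < 1 := fun x hx ↦ by
    rw [norm_div, div_lt_one (hn0.trans hx.1)]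
    exact hx.1
  have hTd : ∀ x ∈ A, DifferentiableAt ℂ T x := fun x hx ↦
    ((differentiable_qPoch hq _).comp x (by fun_prop)).mul
      ((differentiable_qPoch hq (q / x)).comp x (by fun_prop (disch := exact hA0 x hx)))
  have hT0 : ∀ x ∈ A, T x ≠ 0 := fun x hx ↦
    mul_ne_zero (qPoch_ne_zero hq (hAm x hx)) (qPoch_ne_zero hq (hAd x hx))
  have hRd : ∀ x ∈ A, DifferentiableAt ℂ R x := fun x hx ↦
    ((differentiableAt_koebeSum hq (hAm x hx)).comp x (by fun_prop)).add
      ((differentiableAt_koebeSum hq (hAd x hx)).comp x (by fun_prop (disch := exact hA0 x hx)))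
  have hWd : ∀ x ∈ A, DifferentiableAt ℂ W x := fun x hx ↦
    (DifferentiableAt.comp (f := fun x ↦ x * y) x
      (differentiableAt_qTheta hq (mul_ne_zero (hA0 x hx) hy)) (by fun_prop)).mul
      (DifferentiableAt.comp (f := fun x ↦ x / y) x
        (differentiableAt_qTheta hq (div_ne_zero (hA0 x hx) hy)) (by fun_prop))
  have hkd : ∀ x ∈ A, DifferentiableAt ℂ k x := fun x hx ↦ by
    have := hTd x hx
    have := hRd x hx
    have := hWd x hx
    fun_prop
  have hWinv : ∀ x, x ≠ 0 → x ^ 2 * W x⁻¹ = W x := fun x hx ↦ by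
    have e1 : x⁻¹ * y = (x / y)⁻¹ := by field_simp
    have e2 : x⁻¹ / y = (x * y)⁻¹ := by field_simp
    simp only [hW]
    rw [e1, e2, qTheta_inv hq (div_ne_zero hx hy), qTheta_inv hq (mul_ne_zero hx hy)]
    field_simp
  have hWmul : ∀ x, x ≠ 0 → W (q * x) = (x ^ 2)⁻¹ * W x := fun x hx ↦ by
    simp only [hW]
    rw [mul_assoc, mul_div_assoc, qTheta_mul hq hq0 (div_ne_zero hx hy),
      qTheta_mul hq hq0 (mul_ne_zero hx hy)]
    field_simp
  have hk1 : k 1 = 0 := by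
    simp only [hk, hT, hW, hK, one_mul, sub_self, mul_one, div_one, one_div]
    rw [qTheta_inv hq hy]
    field_simp
    ring
  have hkinv : ∀ x, x ≠ 0 → x ^ 2 * k x⁻¹ = k x := fun x hx ↦ by
    have eT : T x⁻¹ = T x := by
      simp only [hT, div_eq_mul_inv, inv_inv]
      ring
    have eR : R x⁻¹ = R x := by
      simp only [hR, div_eq_mul_inv, inv_inv]
      ring
    have eW := hWinv x hx
    simp only [hk, eT, eR]
    rw [← eW]
    field_simp
    ring
  have hk1' : deriv k 1 = 0 := by
    have hd := (hkd 1 h1A).hasDerivAt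
    have hi : HasDerivAt (fun x : ℂ ↦ k x⁻¹) (deriv k 1 * (-(1 ^ 2)⁻¹)) 1 :=
      HasDerivAt.comp (1 : ℂ) (h₂ := k) (h := fun x ↦ x⁻¹) (by simpa using hd)
        (hasDerivAt_inv one_ne_zero)
    have hp := (hasDerivAt_pow 2 (1 : ℂ)).mul hi
    have he : (fun x : ℂ ↦ x ^ 2) * (fun x ↦ k x⁻¹) =ᶠ[𝓝 1] k := by
      filter_upwards [isOpen_ne.mem_nhds (one_ne_zero (α := ℂ))] with x hx using hkinv x hx
    have := (hp.congr_of_eventuallyEq he.symm).unique hd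
    simp only [inv_one, hk1] at this
    have h2 : 2 * deriv k 1 = 0 := by linear_combination -this
    simpa using h2
  set d1 := dslope k 1 with hd1
  set d2 := dslope d1 1 with hd2
  have hkA : DifferentiableOn ℂ k A := fun x hx ↦ (hkd x hx).differentiableWithinAt
  have hd2A : DifferentiableOn ℂ d2 A :=
    (Complex.differentiableOn_dslope (hAo.mem_nhds h1A)).mpr
      ((Complex.differentiableOn_dslope (hAo.mem_nhds h1A)).mpr hkA)
  have hkd2 : ∀ x, x ≠ 1 → k x = (x - 1) ^ 2 * d2 x := fun x hx ↦ by
    have hx1 : x - 1 ≠ 0 := sub_ne_zero.mpr hx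
    rw [hd2, dslope_of_ne _ hx, slope_def_field, hd1, dslope_same, hk1', dslope_of_ne _ hx,
      slope_def_field, hk1]
    field_simp
    ring
  have hth : ∀ x, qTheta q x = (1 - x) * T x := fun x ↦ qTheta_eq_mul hq x
  set f : ℂ → ℂ := fun x ↦ if qTheta q x = 0 then d2 1 / T 1 ^ 2 else h x with hf
  have hfA : ∀ x ∈ A, f x = d2 x / T x ^ 2 := fun x hx ↦ by
    by_cases hx1 : x = 1
    · subst hx1
      simp [hf, qTheta_one hq]
    · have hx2 : 1 - x ≠ 0 := sub_ne_zero.mpr (Ne.symm hx1)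
      have hTx := hT0 x hx
      have : qTheta q x ≠ 0 := by
        rw [hth]
        exact mul_ne_zero hx2 hTx
      have hkx := hkd2 x hx1
      simp only [hf, this, if_false]
      have e : h x = k x / ((1 - x) ^ 2 * T x ^ 2) := by
        simp only [hh, hk, hth, qWeierstrass_eq_add hq x, koebe]
        field_simp
        simp only [hR]
        ring_nf
      rw [e, hkx]
      field_simp
      ring
  have hfd : ∀ x, ‖q‖ < ‖x‖ → ‖x‖ < ‖q‖⁻¹ → DifferentiableAt ℂ f x := fun x h1 h2 ↦ by
    have hx : x ∈ A := ⟨h1, h2⟩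
    have hdd : DifferentiableAt ℂ (fun x ↦ d2 x / T x ^ 2) x :=
      (hd2A.differentiableAt (hAo.mem_nhds hx)).div ((hTd x hx).pow 2) (pow_ne_zero _ (hT0 x hx))
    exact hdd.congr_of_eventuallyEq (eventually_of_mem (hAo.mem_nhds hx) hfA)
  have hfm : ∀ x, x ≠ 0 → f (q * x) = f x := fun x hx ↦ by
    have hm := qTheta_mul hq hq0 hx
    by_cases h0 : qTheta q x = 0
    · simp [hf, hm, h0]
    · have : qTheta q (q * x) ≠ 0 := by
        rw [hm]
        exact mul_ne_zero (neg_ne_zero.mpr (inv_ne_zero hx)) h0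
      simp only [hf, this, h0, if_false, hh]
      rw [qWeierstrass_mul hq hq0 hx, hWmul x hx, hm]
      field_simp
  have hfin := eq_of_differentiableOn_annulus_of_mul_invariant hq hq0 hfd hfm hx hy
  simp only [hf, hx', hy', if_false, hh, sub_self, hW, div_self hy, qTheta_one hq, mul_zero,
    zero_div] at hfin
  rw [sub_eq_zero.mp hfin, hK]
  field_simp

section EtaProducts

variable {q : ℂ}

/-- The Euler product `∏ n ≥ 1, (1 - q ^ n)`. -/
noncomputable def eulerProd (q : ℂ) : ℂ := qPoch q q

lemma norm_pow_lt_one_of_ne_zero (hq : ‖q‖ < 1) {n : ℕ} (hn : n ≠ 0) : ‖q ^ n‖ < 1 := by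
  simpa using pow_lt_one₀ (norm_nonneg _) hq hn

lemma eulerProd_ne_zero (hq : ‖q‖ < 1) : eulerProd q ≠ 0 := qPoch_ne_zero hq hq

/-- `(q; q²)_∞ (q²; q²)_∞ = (q; q)_∞`. -/
lemma qPoch_sq_mul_eulerProd (hq : ‖q‖ < 1) :
    qPoch (q ^ 2) q * eulerProd (q ^ 2) = eulerProd q := by
  rw [eulerProd, eulerProd, qPoch_bisect hq q, pow_two]

/-- `(-q; q)_∞ (q; q)_∞ = (q²; q²)_∞`. -/
lemma qPoch_neg_mul_eulerProd (hq : ‖q‖ < 1) :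
    qPoch q (-q) * eulerProd q = eulerProd (q ^ 2) := by
  rw [eulerProd, eulerProd, mul_comm, qPoch_mul_neg hq]

/-- `(-q; q²)_∞ = (q²; q²)²_∞ / ((q; q)_∞ (q⁴; q⁴)_∞)`. -/
lemma qPoch_sq_neg_mul (hq : ‖q‖ < 1) :
    qPoch (q ^ 2) (-q) * (eulerProd q * eulerProd (q ^ 4)) = eulerProd (q ^ 2) ^ 2 := by
  have hq2 := norm_pow_lt_one_of_ne_zero hq two_ne_zero
  have h1 := qPoch_mul_neg hq2 q
  have h2 := qPoch_sq_mul_eulerProd hq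
  have h3 := qPoch_sq_mul_eulerProd hq2
  simp only [← pow_mul, Nat.reduceMul] at h1 h2 h3
  rw [← h2]
  linear_combination eulerProd (q ^ 2) * eulerProd (q ^ 4) * h1 + eulerProd (q ^ 2) * h3

lemma qTheta_pow_four_self (hq : ‖q‖ < 1) (hq0 : q ≠ 0) :
    qTheta (q ^ 4) q * eulerProd (q ^ 2) = eulerProd q := by
  have hq2 := norm_pow_lt_one_of_ne_zero hq two_ne_zero
  have h1 := qPoch_bisect hq2 q
  have h2 : q ^ 4 / q = q * q ^ 2 := by field_simp
  rw [← qPoch_sq_mul_eulerProd hq, h1, qTheta, h2]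
  ring_nf

lemma qTheta_pow_four_neg (hq : ‖q‖ < 1) (hq0 : q ≠ 0) :
    qTheta (q ^ 4) (-q) * (eulerProd q * eulerProd (q ^ 4)) = eulerProd (q ^ 2) ^ 2 := by
  have hq2 := norm_pow_lt_one_of_ne_zero hq two_ne_zero
  have h1 := qPoch_bisect hq2 (-q)
  have h2 : q ^ 4 / -q = -q * q ^ 2 := by field_simp
  rw [← qPoch_sq_neg_mul hq, h1, qTheta, h2]
  ring_nf

lemma qTheta_sq_self (hq : ‖q‖ < 1) (hq0 : q ≠ 0) :
    qTheta (q ^ 2) q * eulerProd (q ^ 2) ^ 2 = eulerProd q ^ 2 := by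
  have h2 : q ^ 2 / q = q := by field_simp
  rw [← qPoch_sq_mul_eulerProd hq, qTheta, h2]
  ring

lemma qTheta_sq_neg (hq : ‖q‖ < 1) (hq0 : q ≠ 0) :
    qTheta (q ^ 2) (-q) * (eulerProd q * eulerProd (q ^ 4)) ^ 2 = eulerProd (q ^ 2) ^ 4 := by
  have h2 : q ^ 2 / -q = -q := by field_simp
  have h := qPoch_sq_neg_mul hq
  rw [qTheta, h2]
  linear_combination (qPoch (q ^ 2) (-q) * (eulerProd q * eulerProd (q ^ 4)) +
    eulerProd (q ^ 2) ^ 2) * h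

lemma qTheta_neg_one (hq : ‖q‖ < 1) :
    qTheta q (-1) * eulerProd q ^ 2 = 2 * eulerProd (q ^ 2) ^ 2 := by
  have h := qPoch_neg_mul_eulerProd hq
  have e1 : q * -1 = -q := by ring
  have e2 : q / -1 = -q := by ring
  rw [qTheta_eq_mul hq, e1, e2]
  linear_combination 2 * (qPoch q (-q) * eulerProd q + eulerProd (q ^ 2)) * h

/-- The eta form of `φ(-q)² + 4 q ψ(q⁴)² = φ(q²)²`. -/
theorem eulerProd_identity (hq : ‖q‖ < 1) (hq0 : q ≠ 0) :
    eulerProd q ^ 4 * eulerProd (q ^ 2) ^ 2 * eulerProd (q ^ 4) ^ 2 * eulerProd (q ^ 8) ^ 4 +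
      4 * q * eulerProd (q ^ 2) ^ 4 * eulerProd (q ^ 8) ^ 8 = eulerProd (q ^ 4) ^ 12 := by
  have hq2 := norm_pow_lt_one_of_ne_zero hq two_ne_zero
  have hq4 := norm_pow_lt_one_of_ne_zero hq four_ne_zero
  have hq8 := norm_pow_lt_one_of_ne_zero hq (n := 8) (by norm_num)
  have hq20 := pow_ne_zero 2 hq0
  have hq40 := pow_ne_zero 4 hq0
  have n1 := eulerProd_ne_zero hq
  have n2 := eulerProd_ne_zero hq2
  have n4 := eulerProd_ne_zero hq4
  have n8 := eulerProd_ne_zero hq8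
  have t1 := eq_div_of_mul_eq n2 (qTheta_pow_four_self hq hq0)
  have t2 := eq_div_of_mul_eq (mul_ne_zero n1 n4) (qTheta_pow_four_neg hq hq0)
  have t3 := qTheta_sq_self hq2 hq20
  have t4 := qTheta_sq_neg hq2 hq20
  have t5 := qTheta_neg_one hq4
  simp only [← pow_mul, Nat.reduceMul] at t3 t4 t5
  replace t3 := eq_div_of_mul_eq (pow_ne_zero 2 n4) t3
  replace t4 := eq_div_of_mul_eq (pow_ne_zero 2 (mul_ne_zero n2 n8)) t4
  replace t5 := eq_div_of_mul_eq (pow_ne_zero 2 n4) t5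
  have z2 : qTheta (q ^ 4) (-q) ≠ 0 := by rw [t2]; positivity
  have z3 : qTheta (q ^ 4) (q ^ 2) ≠ 0 := by rw [t3]; positivity
  have z4 : qTheta (q ^ 4) (-q ^ 2) ≠ 0 := by rw [t4]; positivity
  have hnq := neg_ne_zero.mpr hq0
  have hnq2 := neg_ne_zero.mpr hq20
  have A := qWeierstrass_sub hq4 hq40 hq20 hnq2 z3 z4
  have B := qWeierstrass_sub hq4 hq40 hnq2 hnq z4 z2
  have C := qWeierstrass_sub hq4 hq40 hq20 hnq z3 z2
  have a1 : q ^ 2 * -q ^ 2 = q ^ 4 * -1 := by ring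
  have a2 : q ^ 2 / -q ^ 2 = -1 := by field_simp
  have b1 : -q ^ 2 * -q = q ^ 4 * q⁻¹ := by field_simp
  have b2 : -q ^ 2 / -q = q := by field_simp
  have c1 : q ^ 2 * -q = q ^ 4 * (-q)⁻¹ := by field_simp
  have c2 : q ^ 2 / -q = -q := by field_simp
  rw [a1, a2, qTheta_mul hq4 hq40 (by norm_num)] at A
  rw [b1, b2, qTheta_mul hq4 hq40 (inv_ne_zero hq0), qTheta_inv hq4 hq0] at B
  rw [c1, c2, qTheta_mul hq4 hq40 (inv_ne_zero hnq), qTheta_inv hq4 hnq] at C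
  have D := C.symm.trans ((sub_add_sub_cancel _ _ _).symm.trans (congrArg₂ (· + ·) A B))
  rw [t1, t2, t3, t4, t5, ← eulerProd] at D
  field_simp at D
  linear_combination -D

lemma qTheta_pow_eight_mul (hq : ‖q‖ < 1) (hq0 : q ≠ 0) :
    qTheta (q ^ 8) q * qTheta (q ^ 8) (q ^ 3) * eulerProd (q ^ 2) = eulerProd q := by
  have hq2 := norm_pow_lt_one_of_ne_zero hq two_ne_zero
  have hq4 := norm_pow_lt_one_of_ne_zero hq four_ne_zero
  have h1 := qPoch_bisect hq2 q
  have h2 := qPoch_bisect hq4 q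
  have h3 := qPoch_bisect hq4 (q ^ 3)
  have e1 : q ^ 8 / q = q ^ 7 := by field_simp
  have e2 : q ^ 8 / q ^ 3 = q ^ 5 := by field_simp
  have e3 : q * q ^ 2 = q ^ 3 := by ring
  have e4 : q * q ^ 4 = q ^ 5 := by ring
  have e5 : q ^ 3 * q ^ 4 = q ^ 7 := by ring
  simp only [← pow_mul, Nat.reduceMul, e3, e4, e5] at h1 h2 h3
  rw [← qPoch_sq_mul_eulerProd hq, h1, h2, h3, qTheta, qTheta, e1, e2]
  ring

theorem qWeierstrass_sub_pow_eight (hq : ‖q‖ < 1) (hq0 : q ≠ 0) :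
    qWeierstrass (q ^ 8) q - qWeierstrass (q ^ 8) (q ^ 3) =
      q * eulerProd (q ^ 2) ^ 3 * eulerProd (q ^ 4) * eulerProd (q ^ 8) ^ 2 / eulerProd q ^ 2 := by
  have hq2 := norm_pow_lt_one_of_ne_zero hq two_ne_zero
  have hq4 := norm_pow_lt_one_of_ne_zero hq four_ne_zero
  have hq8 := norm_pow_lt_one_of_ne_zero hq (n := 8) (by norm_num)
  have n1 := eulerProd_ne_zero hq
  have n2 := eulerProd_ne_zero hq2
  have n4 := eulerProd_ne_zero hq4
  have n8 := eulerProd_ne_zero hq8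
  have t1 := qTheta_pow_eight_mul hq hq0
  have t2 := qTheta_sq_self hq4 (pow_ne_zero 4 hq0)
  have t3 := qTheta_pow_four_self hq2 (pow_ne_zero 2 hq0)
  simp only [← pow_mul, Nat.reduceMul] at t2 t3
  have z : qTheta (q ^ 8) q * qTheta (q ^ 8) (q ^ 3) ≠ 0 := left_ne_zero_of_mul (t1 ▸ n1)
  replace t1 := eq_div_of_mul_eq n2 t1
  replace t2 := eq_div_of_mul_eq (pow_ne_zero 2 n8) t2
  replace t3 := eq_div_of_mul_eq n4 t3
  have a1 : q * q ^ 3 = q ^ 4 := by ring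
  have a2 : q / q ^ 3 = (q ^ 2)⁻¹ := by field_simp
  rw [qWeierstrass_sub hq8 (pow_ne_zero 8 hq0) hq0 (pow_ne_zero 3 hq0) (left_ne_zero_of_mul z)
    (right_ne_zero_of_mul z), ← mul_pow, t1, a1, a2, qTheta_inv hq8 (pow_ne_zero 2 hq0), t2, t3,
    ← eulerProd]
  field_simp

lemma qTheta_of_sq_eq_neg_one (hq : ‖q‖ < 1) {w : ℂ} (hw : w ^ 2 = -1) :
    qTheta q w * eulerProd (q ^ 2) = (1 - w) * eulerProd (q ^ 4) := by
  have hq2 := norm_pow_lt_one_of_ne_zero hq two_ne_zero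
  have h := qPoch_neg_mul_eulerProd hq2
  have h1 := qPoch_mul_neg hq (q * w)
  have e1 : q / w = -(q * w) := by
    have : w ≠ 0 := by rintro rfl; norm_num at hw
    rw [div_eq_iff this]
    linear_combination q * hw
  have e2 : (q * w) ^ 2 = -q ^ 2 := by linear_combination q ^ 2 * hw
  simp only [← pow_mul, Nat.reduceMul] at h
  rw [e2] at h1
  rw [qTheta_eq_mul hq, e1, h1, ← h, mul_assoc]

lemma qTheta_mul_of_pow_four_eq_neg_one (hq : ‖q‖ < 1) {z : ℂ} (hz : z ^ 4 = -1) :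
    qTheta q z * qTheta q (z ^ 3) * eulerProd (q ^ 4) =
      (1 - z) * (1 - z ^ 3) * eulerProd (q ^ 8) := by
  have hq2 := norm_pow_lt_one_of_ne_zero hq two_ne_zero
  have hq4 := norm_pow_lt_one_of_ne_zero hq four_ne_zero
  have hz0 : z ≠ 0 := by rintro rfl; norm_num at hz
  have h := qPoch_neg_mul_eulerProd hq4
  have h1 := qPoch_mul_neg hq (q * z)
  have h2 := qPoch_mul_neg hq (q * z ^ 3)
  have h3 := qPoch_mul_neg hq2 ((q * z) ^ 2)
  have e1 : q / z = -(q * z ^ 3) := by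
    rw [div_eq_iff hz0]
    linear_combination q * hz
  have e2 : q / z ^ 3 = -(q * z) := by
    rw [div_eq_iff (pow_ne_zero 3 hz0)]
    linear_combination q * hz
  have e3 : (q * z ^ 3) ^ 2 = -(q * z) ^ 2 := by linear_combination q ^ 2 * z ^ 2 * hz
  have e4 : ((q * z) ^ 2) ^ 2 = -q ^ 4 := by linear_combination q ^ 4 * hz
  simp only [← pow_mul, Nat.reduceMul] at h
  rw [e3] at h2
  rw [e4, ← pow_mul] at h3
  rw [qTheta_eq_mul hq, qTheta_eq_mul hq, e1, e2, ← h, ← h3, ← h1, ← h2]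
  ring

theorem qWeierstrass_sub_of_pow_four_eq_neg_one (hq : ‖q‖ < 1) (hq0 : q ≠ 0) {z : ℂ}
    (hz : z ^ 4 = -1) :
    qWeierstrass q z - qWeierstrass q (z ^ 3) =
      (z ^ 3 - z) * (eulerProd q ^ 2 * eulerProd (q ^ 2) * eulerProd (q ^ 4) ^ 3 /
        eulerProd (q ^ 8) ^ 2) := by
  have hq2 := norm_pow_lt_one_of_ne_zero hq two_ne_zero
  have hq4 := norm_pow_lt_one_of_ne_zero hq four_ne_zero
  have hq8 := norm_pow_lt_one_of_ne_zero hq (n := 8) (by norm_num)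
  have n1 := eulerProd_ne_zero hq
  have n2 := eulerProd_ne_zero hq2
  have n4 := eulerProd_ne_zero hq4
  have n8 := eulerProd_ne_zero hq8
  have hz0 : z ≠ 0 := by rintro rfl; norm_num at hz
  have hc : ((1 - z) * (1 - z ^ 3)) ^ 2 = -2 := by
    linear_combination (z ^ 4 - 2 * z ^ 3 + z ^ 2 - 2 * z + 3) * hz
  have hc0 : (1 - z) * (1 - z ^ 3) ≠ 0 := by
    intro h
    rw [h] at hc
    norm_num at hc
  have a1 : z * z ^ 3 = -1 := by rw [← hz]; ring
  have a2 : z / z ^ 3 = -z ^ 2 := by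
    rw [div_eq_iff (pow_ne_zero 3 hz0)]
    linear_combination z * hz
  have t1 := qTheta_mul_of_pow_four_eq_neg_one hq hz
  have t2 := eq_div_of_mul_eq (pow_ne_zero 2 n1) (qTheta_neg_one hq)
  have t3 := eq_div_of_mul_eq n2 (qTheta_of_sq_eq_neg_one hq (w := -z ^ 2)
    (by rw [← hz]; ring))
  have w : qTheta q z * qTheta q (z ^ 3) ≠ 0 :=
    left_ne_zero_of_mul (t1 ▸ mul_ne_zero hc0 n8)
  replace t1 := eq_div_of_mul_eq n4 t1
  rw [qWeierstrass_sub hq hq0 hz0 (pow_ne_zero 3 hz0) (left_ne_zero_of_mul w)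
    (right_ne_zero_of_mul w), ← mul_pow, t1, a1, a2, t2, t3, div_pow, mul_pow, hc, ← eulerProd]
  field_simp
  linear_combination hz

end EtaProducts

section Lambert

variable {q : ℂ}

lemma hasSum_sum_divisors {F : ℕ → ℕ → ℂ} (hF : Summable fun c : ℕ+ × ℕ+ ↦ F c.1 c.2) :
    HasSum (fun n : ℕ+ ↦ ∑ d ∈ (n : ℕ).divisors, F d (n / d)) (∑' c : ℕ+ × ℕ+, F c.1 c.2) := by
  have h := (sigmaAntidiagonalEquivProd.hasSum_iff.mpr hF.hasSum).sigma
    fun n ↦ hasSum_fintype _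
  convert h using 2 with n
  rw [← Nat.sum_divisorsAntidiagonal, ← Finset.sum_coe_sort]
  rfl

lemma norm_chi_eight_le (d : ℕ) : ‖(ZMod.χ₈ (d : ZMod 8) : ℂ)‖ ≤ 1 := by
  rw [ZMod.χ₈_nat_eq_if_mod_eight]
  split_ifs <;> simp

lemma summable_chi_mul_pow_right (hq : ‖q‖ < 1) : Summable fun c : ℕ+ × ℕ+ ↦
    ((c.2 : ℕ) : ℂ) * (ZMod.χ₈ ((c.1 : ℕ) : ZMod 8) : ℂ) * q ^ ((c.1 : ℕ) * (c.2 : ℕ)) := by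
  refine (summable_prod_mul_pow 1 hq).norm.of_norm_bounded fun c ↦ ?_
  simp only [norm_mul, pow_one]
  gcongr
  exact mul_le_of_le_one_right (norm_nonneg _) (norm_chi_eight_le _)

lemma summable_chi_mul_pow_left (hq : ‖q‖ < 1) : Summable fun c : ℕ+ × ℕ+ ↦
    ((c.1 : ℕ) : ℂ) * (ZMod.χ₈ ((c.1 : ℕ) : ZMod 8) : ℂ) * q ^ ((c.1 : ℕ) * (c.2 : ℕ)) := by
  refine (summable_prod_mul_pow 1 hq).prod_symm.norm.of_norm_bounded fun c ↦ ?_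
  simp only [norm_mul, pow_one, Prod.fst_swap, Prod.snd_swap, mul_comm (c.2 : ℕ)]
  gcongr
  exact mul_le_of_le_one_right (norm_nonneg _) (norm_chi_eight_le _)

/-- The Gauss sum representation of the character `χ₈`. -/
lemma gauss_sum_chi_eight {z : ℂ} (hz : z ^ 4 = -1) (m : ℕ) :
    z ^ m + (-z ^ 3) ^ m - (z ^ 3) ^ m - (-z) ^ m =
      2 * (z - z ^ 3) * (ZMod.χ₈ (m : ZMod 8) : ℂ) := by
  have h8 : z ^ 8 = 1 := by linear_combination (z ^ 4 - 1) * hz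
  have key : ∀ w : ℂ, w ^ 8 = 1 → w ^ m = w ^ (m % 8) := fun w hw ↦ pow_eq_pow_mod m hw
  rw [key z h8, key (-z ^ 3) (by linear_combination (z ^ 16 + z ^ 8 + 1) * h8),
    key (z ^ 3) (by linear_combination (z ^ 16 + z ^ 8 + 1) * h8),
    key (-z) (by linear_combination h8), ZMod.χ₈_nat_eq_if_mod_eight]
  have hlt : m % 8 < 8 := Nat.mod_lt _ (by norm_num)
  have h2 : m % 2 = m % 8 % 2 := by omega
  rw [h2]
  generalize m % 8 = r at hlt
  interval_cases r <;> norm_num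
  · ring
  · linear_combination -2 * z * h8
  · linear_combination (2 * z - 2 * z ^ 3 * (z ^ 8 - z ^ 4 + 1)) * hz
  · linear_combination (2 * z ^ 3 - 2 * z * (z ^ 16 - z ^ 12 + z ^ 8 - z ^ 4 + 1)) * hz

lemma hasSum_koebe {t : ℂ} (ht : ‖t‖ < 1) :
    HasSum (fun n : ℕ+ ↦ ((n : ℕ) : ℂ) * t ^ (n : ℕ)) (koebe t) := by
  have h := hasSum_coe_mul_geometric_of_norm_lt_one ht
  have hs : Summable fun n : ℕ+ ↦ ((n : ℕ) : ℂ) * t ^ (n : ℕ) :=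
    h.summable.comp_injective PNat.coe_injective
  have := tsum_zero_pnat_eq_tsum_nat h.summable
  rw [h.tsum_eq] at this
  rw [hs.hasSum_iff, koebe, ← this]
  simp

lemma hasSum_nat_mul_chi_mul_pow {z : ℂ} (hz : z ^ 4 = -1) {t : ℂ} (ht : ‖t‖ < 1) :
    HasSum (fun n : ℕ+ ↦ 2 * (z - z ^ 3) *
      (((n : ℕ) : ℂ) * (ZMod.χ₈ ((n : ℕ) : ZMod 8) : ℂ) * t ^ (n : ℕ)))
      (koebe (z * t) + koebe (-z ^ 3 * t) - koebe (z ^ 3 * t) - koebe (-z * t)) := by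
  have hn : ‖z‖ = 1 := (pow_eq_one_iff_of_nonneg (norm_nonneg z) four_ne_zero).mp (by
    rw [← norm_pow, hz]; simp)
  have h := (((hasSum_koebe (t := z * t) (by simpa [hn])).add
    (hasSum_koebe (t := -z ^ 3 * t) (by simpa [hn]))).sub
    (hasSum_koebe (t := z ^ 3 * t) (by simpa [hn]))).sub
    (hasSum_koebe (t := -z * t) (by simpa [hn]))
  refine h.congr_fun fun n ↦ ?_
  rw [mul_pow, mul_pow, mul_pow, mul_pow]
  linear_combination -((n : ℕ) : ℂ) * t ^ (n : ℕ) * gauss_sum_chi_eight hz n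

theorem tsum_chi_mul_pow_left (hq : ‖q‖ < 1) {z : ℂ} (hz : z ^ 4 = -1) :
    2 * (z - z ^ 3) * ∑' c : ℕ+ × ℕ+, ((c.1 : ℕ) : ℂ) * (ZMod.χ₈ ((c.1 : ℕ) : ZMod 8) : ℂ) *
      q ^ ((c.1 : ℕ) * (c.2 : ℕ)) =
      (qWeierstrass q z - qWeierstrass q (z ^ 3)) + (z - z ^ 3) := by
  have hz0 : z ≠ 0 := by rintro rfl; norm_num at hz
  have hs := (summable_chi_mul_pow_left hq).prod_symm
  rw [← (Equiv.prodComm ℕ+ ℕ+).tsum_eq]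
  change _ * ∑' c : ℕ+ × ℕ+, (fun c : ℕ+ × ℕ+ ↦
    ((c.1 : ℕ) : ℂ) * (ZMod.χ₈ ((c.1 : ℕ) : ZMod 8) : ℂ) * q ^ ((c.1 : ℕ) * (c.2 : ℕ))) c.swap = _
  rw [hs.tsum_prod, ← tsum_mul_left]
  have inner : ∀ m : ℕ+, 2 * (z - z ^ 3) * ∑' d : ℕ+,
      ((d : ℕ) : ℂ) * (ZMod.χ₈ ((d : ℕ) : ZMod 8) : ℂ) * q ^ ((d : ℕ) * (m : ℕ)) =
      koebe (z * q ^ (m : ℕ)) + koebe (-z ^ 3 * q ^ (m : ℕ)) - koebe (z ^ 3 * q ^ (m : ℕ)) -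
        koebe (-z * q ^ (m : ℕ)) := fun m ↦ by
    rw [← tsum_mul_left, ← (hasSum_nat_mul_chi_mul_pow hz
      (norm_pow_lt_one_of_ne_zero hq m.ne_zero)).tsum_eq]
    simp only [← pow_mul, mul_comm (m : ℕ)]
  simp only [Prod.fst_swap, Prod.snd_swap, inner]
  rw [tsum_pnat_eq_tsum_succ (f := fun m ↦ koebe (z * q ^ m) + koebe (-z ^ 3 * q ^ m) -
    koebe (z ^ 3 * q ^ m) - koebe (-z * q ^ m))]
  have e : ∀ w : ℂ, (fun n : ℕ ↦ koebe (w * q ^ (n + 1))) = fun n ↦ koebe (q * w * q ^ n) :=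
    fun w ↦ by ext n; ring_nf
  have hsum : ∀ w : ℂ, Summable fun n : ℕ ↦ koebe (w * q ^ (n + 1)) := fun w ↦ by
    rw [e]; exact summable_koebe hq _
  have ht : ∀ w : ℂ, ∑' n : ℕ, koebe (w * q ^ (n + 1)) = koebeSum q (q * w) := fun w ↦ by
    rw [e, koebeSum]
  rw [(((hsum _).add (hsum _)).sub (hsum _)).tsum_sub (hsum _),
    ((hsum _).add (hsum _)).tsum_sub (hsum _), (hsum _).tsum_add (hsum _), ht, ht, ht, ht]
  have e1 : q / z = q * -z ^ 3 := by
    rw [div_eq_iff hz0]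
    linear_combination q * hz
  have e2 : q / z ^ 3 = q * -z := by
    rw [div_eq_iff (pow_ne_zero 3 hz0)]
    linear_combination q * hz
  have hk : koebe z - koebe (z ^ 3) = -(z - z ^ 3) := by
    have d1 : (1 - z) ≠ 0 := by
      intro h
      rw [← sub_eq_zero.mp h] at hz
      norm_num at hz
    have d2 : (1 - z ^ 3) ≠ 0 := by
      intro h
      have : (z ^ 3) ^ 4 = -1 := by linear_combination (z ^ 8 - z ^ 4 + 1) * hz
      rw [← sub_eq_zero.mp h] at this
      norm_num at this
    have hc : ((1 - z) * (1 - z ^ 3)) ^ 2 = -2 := by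
      linear_combination (z ^ 4 - 2 * z ^ 3 + z ^ 2 - 2 * z + 3) * hz
    rw [koebe, koebe, div_sub_div _ _ (pow_ne_zero 2 d1) (pow_ne_zero 2 d2), ← mul_pow, hc]
    linear_combination -1 / 2 * (z ^ 3 - z) * hz
  rw [qWeierstrass_eq_add hq, qWeierstrass_eq_add hq, e1, e2]
  linear_combination -hk

theorem tsum_chi_mul_pow_right (hq : ‖q‖ < 1) (hq0 : q ≠ 0) :
    ∑' c : ℕ+ × ℕ+, ((c.2 : ℕ) : ℂ) * (ZMod.χ₈ ((c.1 : ℕ) : ZMod 8) : ℂ) *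
      q ^ ((c.1 : ℕ) * (c.2 : ℕ)) =
      qWeierstrass (q ^ 8) q - qWeierstrass (q ^ 8) (q ^ 3) := by
  have hq8 := norm_pow_lt_one_of_ne_zero hq (n := 8) (by norm_num)
  rw [(summable_chi_mul_pow_right hq).tsum_prod]
  have inner : ∀ d : ℕ+, ∑' m : ℕ+,
      ((m : ℕ) : ℂ) * (ZMod.χ₈ ((d : ℕ) : ZMod 8) : ℂ) * q ^ ((d : ℕ) * (m : ℕ)) =
      (ZMod.χ₈ ((d : ℕ) : ZMod 8) : ℂ) * koebe (q ^ (d : ℕ)) := fun d ↦ by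
    rw [← (hasSum_koebe (norm_pow_lt_one_of_ne_zero hq d.ne_zero)).tsum_eq, ← tsum_mul_left]
    exact tsum_congr fun m ↦ by rw [pow_mul]; ring
  simp only [inner]
  have hs : Summable fun n : ℕ ↦ (ZMod.χ₈ (n : ZMod 8) : ℂ) * koebe (q ^ n) := by
    refine (summable_koebe hq 1).norm.of_norm_bounded fun n ↦ ?_
    rw [norm_mul, one_mul]
    exact mul_le_of_le_one_left (norm_nonneg _) (norm_chi_eight_le _)
  have h0 := tsum_zero_pnat_eq_tsum_nat hs
  have c0 : ZMod.χ₈ 0 = 0 := rfl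
  simp only [Nat.cast_zero, c0, Int.cast_zero, zero_mul, zero_add] at h0
  rw [h0, Nat.sumByResidueClasses hs 8]
  have hterm : ∀ (j : ZMod 8), ∑' m : ℕ, (ZMod.χ₈ ((j.val + 8 * m : ℕ) : ZMod 8) : ℂ) *
      koebe (q ^ (j.val + 8 * m)) = (ZMod.χ₈ j : ℂ) * koebeSum (q ^ 8) (q ^ j.val) := fun j ↦ by
    rw [koebeSum, ← tsum_mul_left]
    refine tsum_congr fun m ↦ ?_
    have h8 : (8 : ZMod 8) = 0 := rfl
    simp [h8, pow_add, pow_mul]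
  simp only [hterm]
  have e1 : q ^ 8 / q = q ^ 7 := by field_simp
  have e2 : q ^ 8 / q ^ 3 = q ^ 5 := by field_simp
  rw [qWeierstrass, qWeierstrass, e1, e2]
  change ∑ j : Fin 8, (ZMod.χ₈ j : ℂ) * koebeSum (q ^ 8) (q ^ (j : ℕ)) = _
  rw [Fin.sum_univ_eight]
  have c1 : ZMod.χ₈ (1 : Fin 8) = 1 := rfl
  have c2 : ZMod.χ₈ (2 : Fin 8) = 0 := rfl
  have c3 : ZMod.χ₈ (3 : Fin 8) = -1 := rfl
  have c4 : ZMod.χ₈ (4 : Fin 8) = 0 := rfl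
  have c5 : ZMod.χ₈ (5 : Fin 8) = -1 := rfl
  have c6 : ZMod.χ₈ (6 : Fin 8) = 0 := rfl
  have c7 : ZMod.χ₈ (7 : Fin 8) = 1 := rfl
  have c0 : ZMod.χ₈ (0 : Fin 8) = 0 := rfl
  rw [c0, c1, c2, c3, c4, c5, c6, c7]
  simp
  ring

end Lambert

lemma eta_nat_mul (τ : ℂ) (k : ℕ) :
    ModularForm.eta (k * τ) = Complex.exp (2 * Real.pi * Complex.I * τ / 24) ^ k *
      eulerProd (Complex.exp (2 * Real.pi * Complex.I * τ) ^ k) := by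
  rw [ModularForm.eta, eulerProd, qPoch]
  congr 1
  · rw [Function.Periodic.qParam, ← Complex.exp_nat_mul]
    congr 1
    push_cast
    ring
  · refine tprod_congr fun n ↦ ?_
    rw [ModularForm.eta_q_eq_pow, ← Complex.exp_nat_mul _ k, ← pow_succ']
    congr 3
    ring

theorem mainTheorem8 (τ : UpperHalfPlane) (q : ℂ)
    (hq : q = Complex.exp (2 * (Real.pi : ℂ) * Complex.I * (τ : ℂ))) :
    Summable (fun n : ℕ+ =>
      (∑ d ∈ (n : ℕ).divisors,
        ((d : ℂ) * (ZMod.χ₈ (d : ZMod 8) : ℂ)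
          - 2 * ((n : ℂ) / (d : ℂ)) * (ZMod.χ₈ (d : ZMod 8) : ℂ))) * q ^ (n : ℕ)) ∧
    ModularForm.eta (4 * (τ : ℂ)) ^ 13 /
        (ModularForm.eta (τ : ℂ) ^ 2 * ModularForm.eta (2 * (τ : ℂ)) *
          ModularForm.eta (8 * (τ : ℂ)) ^ 6) =
      1 - 2 * ∑' n : ℕ+,
        (∑ d ∈ (n : ℕ).divisors,
          ((d : ℂ) * (ZMod.χ₈ (d : ZMod 8) : ℂ)
            - 2 * ((n : ℂ) / (d : ℂ)) * (ZMod.χ₈ (d : ZMod 8) : ℂ))) * q ^ (n : ℕ) := by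
  have hq0 : q ≠ 0 := hq ▸ Complex.exp_ne_zero _
  have hq1 : ‖q‖ < 1 := hq ▸ UpperHalfPlane.norm_exp_two_pi_I_lt_one τ
  have hq2 := norm_pow_lt_one_of_ne_zero hq1 two_ne_zero
  have hq4 := norm_pow_lt_one_of_ne_zero hq1 four_ne_zero
  have hq8 := norm_pow_lt_one_of_ne_zero hq1 (n := 8) (by norm_num)
  have n1 := eulerProd_ne_zero hq1
  have n2 := eulerProd_ne_zero hq2
  have n4 := eulerProd_ne_zero hq4
  have n8 := eulerProd_ne_zero hq8
  have sA := summable_chi_mul_pow_left hq1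
  have sB := summable_chi_mul_pow_right hq1
  have hS := hasSum_sum_divisors (F := fun d m ↦ (d : ℂ) * (ZMod.χ₈ (d : ZMod 8) : ℂ) * q ^ (d * m)
    - 2 * ((m : ℂ) * (ZMod.χ₈ (d : ZMod 8) : ℂ) * q ^ (d * m))) (sA.sub (sB.mul_left 2))
  rw [sA.tsum_sub (sB.mul_left 2), tsum_mul_left, tsum_chi_mul_pow_right hq1 hq0,
    qWeierstrass_sub_pow_eight hq1 hq0] at hS
  have hF : (fun n : ℕ+ ↦ ∑ d ∈ (n : ℕ).divisors,
      ((d : ℂ) * (ZMod.χ₈ (d : ZMod 8) : ℂ) * q ^ (d * (n / d)) -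
        2 * (((n / d : ℕ) : ℂ) * (ZMod.χ₈ (d : ZMod 8) : ℂ) * q ^ (d * (n / d))))) =
      fun n : ℕ+ ↦ (∑ d ∈ (n : ℕ).divisors, ((d : ℂ) * (ZMod.χ₈ (d : ZMod 8) : ℂ)
        - 2 * ((n : ℂ) / (d : ℂ)) * (ZMod.χ₈ (d : ZMod 8) : ℂ))) * q ^ (n : ℕ) := by
    ext n
    rw [Finset.sum_mul]
    refine Finset.sum_congr rfl fun d hd ↦ ?_
    have hdvd := Nat.dvd_of_mem_divisors hd
    rw [Nat.mul_div_cancel' hdvd, Nat.cast_div hdvd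
      (Nat.cast_ne_zero.mpr (Nat.pos_of_mem_divisors hd).ne')]
    ring
  rw [hF] at hS
  refine ⟨hS.summable, ?_⟩
  obtain ⟨z, hz⟩ : ∃ z : ℂ, z ^ 4 = -1 := IsAlgClosed.exists_pow_nat_eq _ (by norm_num)
  have hA := tsum_chi_mul_pow_left hq1 hz
  rw [qWeierstrass_sub_of_pow_four_eq_neg_one hq1 hq0 hz] at hA
  have hzz : z - z ^ 3 ≠ 0 := fun h ↦ by
    have : (z - z ^ 3) ^ 2 = 2 := by linear_combination (z ^ 2 - 2) * hz
    norm_num [h] at this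
  have hA2 : 1 - 2 * ∑' c : ℕ+ × ℕ+, ((c.1 : ℕ) : ℂ) * (ZMod.χ₈ ((c.1 : ℕ) : ZMod 8) : ℂ) *
      q ^ ((c.1 : ℕ) * (c.2 : ℕ)) = eulerProd q ^ 2 * eulerProd (q ^ 2) * eulerProd (q ^ 4) ^ 3 /
        eulerProd (q ^ 8) ^ 2 := by
    apply mul_left_cancel₀ hzz
    linear_combination -hA
  have E1 := eta_nat_mul τ 1
  have E2 := eta_nat_mul τ 2
  have E4 := eta_nat_mul τ 4
  have E8 := eta_nat_mul τ 8
  rw [← hq] at E1 E2 E4 E8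
  push_cast at E1 E2 E4 E8
  simp only [one_mul, pow_one] at E1
  have hid := eulerProd_identity hq1 hq0
  have hLHS : ModularForm.eta (4 * (τ : ℂ)) ^ 13 /
        (ModularForm.eta (τ : ℂ) ^ 2 * ModularForm.eta (2 * (τ : ℂ)) *
          ModularForm.eta (8 * (τ : ℂ)) ^ 6) = eulerProd (q ^ 4) ^ 13 /
        (eulerProd q ^ 2 * eulerProd (q ^ 2) * eulerProd (q ^ 8) ^ 6) := by
    have := Complex.exp_ne_zero (2 * Real.pi * Complex.I * τ / 24)
    rw [E1, E2, E4, E8]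
    field_simp
  rw [hLHS, hS.tsum_eq]
  have hR : ∀ a b : ℂ, 1 - 2 * (a - 2 * b) = (1 - 2 * a) + 4 * b := fun a b ↦ by ring
  rw [hR, hA2, pow_succ _ 12, ← hid]
  field_simp
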